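/- **Setting.** All Hilbert spaces are finite dimensional. An observable algebra is an algebra $\mathcal{A}\subset\mathcal{B}(\mathcal{H}_A)$ of all operators that are block diagonal with respect to a fixed orthonormal basis of $\mathcal{H}_A$ partitioned according to the values of a classical variable; this includes the quantum algebras $\mathcal{B}(\mathcal{H})$, the classical algebras $\mathcal{C}(X)$ of diagonal operators on $\mathbb{C}^X$, and the hybrid algebras $\mathcal{C}(X)\otimes\mathcal{B}(\mathcal{H})$. States are density operators in the algebra; operations are completely positive trace preserving maps between algebras. Fix a mailbox algebra $\mathcal{M}\subset\mathcal{B}(\mathcal{H}_M)$ and an even number of rounds $N=2m$. A strategy $\sigma_A\in\Sigma_A(\mathcal{A},\mathcal{M})$ of Alice with notepad algebra $\mathcal{A}$ is a tuple $(\rho_A;T_A^{(2)},T_A^{(4)},\dots,T_A^{(N)};E_A)$ of a state $\rho_A\in\mathcal{A}\otimes\mathcal{M}$, operations $T_A^{(j)}:\mathcal{A}\otimes\mathcal{M}\to\mathcal{A}\otimes\mathcal{M}$ and a positive operator valued measure $E_A=(E_A^{(0)},E_A^{(1)},E_A^{(\emptyset)})$ in $\mathcal{A}$. A strategy $\sigma_B\in\Sigma_B(\mathcal{B},\mathcal{M})$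 of Bob with notepad algebra $\mathcal{B}$ is a tuple $(\rho_B;T_B^{(1)},T_B^{(3)},\dots,T_B^{(N-1)};E_B)$ of a state $\rho_B\in\mathcal{B}$, operations $T_B^{(j)}:\mathcal{M}\otimes\mathcal{B}\to\mathcal{M}\otimes\mathcal{B}$ and a positive operator valued measure $E_B=(E_B^{(0)},E_B^{(1)},E_B^{(\emptyset)})$ in $\mathcal{B}$. Put $$\rho^{(N)}=(T_A^{(N)}\otimes\mathrm{Id}_B)(\mathrm{Id}_A\otimes T_B^{(N-1)})\cdots(T_A^{(2)}\otimes\mathrm{Id}_B)(\mathrm{Id}_A\otimes T_B^{(1)})(\rho_A\otimes\rho_B),$$ $$\mathbb{P}(\sigma_A,\sigma_B;x,y)=\operatorname{tr}\bigl[(E_A^{(x)}\otimes 1\otimes E_B^{(y)})\rho^{(N)}\bigr],\qquad x,y\in\{0,1,\emptyset\}.$$ A strategy is *unitary* if the notepad and mailbox algebras are full matrix algebras, the initial state is pure, every operation has the form $\rho\mapsto U\rho U^*$ with a unitary $U$ on the notepad and mailbox Hilbert space, and all operators of the final measurement are projections. Every strategy $\sigma_B\in\Sigma_B(\mathcal{B},\mathcal{M})$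 can also be played with the mailbox $\mathcal{B}(\mathcal{H}_M)\supset\mathcal{M}$: an *extension* of $\sigma_B$ is a strategy in $\Sigma_B(\mathcal{B},\mathcal{B}(\mathcal{H}_M))$ with the same initial state and measurement, whose operations restrict to those of $\sigma_B$ on $\mathcal{M}\otimes\mathcal{B}$; extensions of Alice's strategies are defined likewise. If $\mathcal{M}=\mathcal{B}(\mathcal{H}_M)$, the only extension of a strategy is the strategy itself. **Proposition (unitary normal form).** For each strategy $\sigma_A\in\Sigma_A(\mathcal{A},\mathcal{M})$ with $\mathcal{A}\subset\mathcal{B}(\mathcal{H}_A)$ there are a finite-dimensional Hilbert space $\mathcal{K}_A$ and a unitary strategy $\tilde\sigma_A\in\Sigma_A(\tilde{\mathcal{A}},\mathcal{B}(\mathcal{H}_M))$ with $\tilde{\mathcal{A}}=\mathcal{B}(\mathcal{H}_A\otimes\mathcal{K}_A)$ such that, for every observable algebra $\mathcal{B}$ and every $\sigma_B\in\Sigma_B(\mathcal{B},\mathcal{M})$: the strategy $\sigma_B$ has an extension to the mailbox $\mathcal{B}(\mathcal{H}_M)$, and for every such extension $\hat\sigma_B$ and all $x,y\in\{0,1,\emptyset\}$,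 $$\mathbb{P}(\sigma_A,\sigma_B;x,y)=\mathbb{P}(\tilde\sigma_A,\hat\sigma_B;x,y).$$ Likewise, for each strategy $\sigma_B\in\Sigma_B(\mathcal{B},\mathcal{M})$ with $\mathcal{B}\subset\mathcal{B}(\mathcal{H}_B)$ there are a finite-dimensional Hilbert space $\mathcal{K}_B$ and a unitary strategy $\tilde\sigma_B\in\Sigma_B(\mathcal{B}(\mathcal{H}_B\otimes\mathcal{K}_B),\mathcal{B}(\mathcal{H}_M))$ such that, for every observable algebra $\mathcal{A}$ and every $\sigma_A\in\Sigma_A(\mathcal{A},\mathcal{M})$: the strategy $\sigma_A$ has an extension to the mailbox $\mathcal{B}(\mathcal{H}_M)$, and $\mathbb{P}(\sigma_A,\sigma_B;x,y)=\mathbb{P}(\hat\sigma_A,\tilde\sigma_B;x,y)$ for every such extension $\hat\sigma_A$ and all $x,y\in\{0,1,\emptyset\}$. -/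

import Mathlib

open scoped Kronecker ComplexOrder

namespace CoinToss

/-- A finite-dimensional observable algebra, presented as a block diagonal subalgebra of the full
matrix algebra `B(H)` of the Hilbert space `H = ℂ^ι`.  The classical part is the set `X`, and `label`
says to which classical value a basis vector of `H` belongs.  The algebra itself is `ObsAlg.alg`. -/
structure ObsAlg where
  /-- index set of the distinguished orthonormal basis of the ambient Hilbert space -/
  ι : Type
  [fintype : Fintype ι]
  [decEq : DecidableEq ι]
  /-- the classical values -/
  X : Type
  label : ι → X

attribute [instance] ObsAlg.fintype ObsAlg.decEq

namespace ObsAlg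

/-- All operators on `ℂ^ι` that are block diagonal with respect to the classical values. -/
def alg (A : ObsAlg) : Submodule ℂ (Matrix A.ι A.ι ℂ) where
  carrier := {ρ | ∀ i j, A.label i ≠ A.label j → ρ i j = 0}
  add_mem' := by
    intro ρ τ hρ hτ i j h
    simp [hρ i j h, hτ i j h]
  zero_mem' := by
    intro i j _
    rfl
  smul_mem' := by
    intro c ρ hρ i j h
    simp [hρ i j h]

/-- The hybrid algebra `C(X) ⊗ B(ℂ^H)`. -/
abbrev hybrid (X H : Type) [Fintype X] [DecidableEq X] [Fintype H] [DecidableEq H] : ObsAlg where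
  ι := X × H
  X := X
  label := Prod.fst

/-- The classical algebra `C(X)`: diagonal matrices. -/
abbrev classical (X : Type) [Fintype X] [DecidableEq X] : ObsAlg where
  ι := X
  X := X
  label := id

/-- The quantum algebra `B(ℂ^H)`: all matrices. -/
abbrev quantum (H : Type) [Fintype H] [DecidableEq H] : ObsAlg where
  ι := H
  X := Unit
  label := fun _ => ()

/-- The tensor product, a subalgebra of `B(ℂ^A ⊗ ℂ^B)`. -/
abbrev tensor (A B : ObsAlg) : ObsAlg where
  ι := A.ι × B.ι
  X := A.X × B.X
  label := Prod.map A.label B.label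

/-- The full matrix algebra `B(H)` of the Hilbert space `H` in which `A ⊆ B(H)` is given. -/
abbrev full (A : ObsAlg) : ObsAlg := quantum A.ι

/-- `A` is a pure quantum algebra: all of `B(H)`. -/
def IsQuantum (A : ObsAlg) : Prop := A.alg = ⊤

theorem kronecker_mem {A B : ObsAlg} {ρ : Matrix A.ι A.ι ℂ} {τ : Matrix B.ι B.ι ℂ}
    (hρ : ρ ∈ A.alg) (hτ : τ ∈ B.alg) : ρ ⊗ₖ τ ∈ (A.tensor B).alg := by
  rintro ⟨a, b⟩ ⟨a', b'⟩ h
  by_cases ha : A.label a = A.label a'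
  · have hb : B.label b ≠ B.label b' := fun hb => h (Prod.ext ha hb)
    simp [Matrix.kroneckerMap_apply, hτ b b' hb]
  · simp [Matrix.kroneckerMap_apply, hρ a a' ha]

/-- The `(c, c')` block of an element of `A ⊗ C`; it lies in `A`. -/
def blockLeft (A C : ObsAlg) (c c' : C.ι) : (A.tensor C).alg →ₗ[ℂ] A.alg where
  toFun ρ := ⟨Matrix.of fun a a' => ρ.1 (a, c) (a', c'),
    fun a a' h => ρ.2 (a, c) (a', c') fun e => h (congrArg Prod.fst e)⟩
  map_add' _ _ := rfl
  map_smul' _ _ := rfl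

theorem blockLeft_eq_zero {A C : ObsAlg} {c c' : C.ι} (h : C.label c ≠ C.label c')
    (ρ : (A.tensor C).alg) : blockLeft A C c c' ρ = 0 := by
  apply Subtype.ext
  ext a a'
  exact ρ.2 (a, c) (a', c') fun e => h (congrArg Prod.snd e)

/-- The `(c, c')` block of an element of `C ⊗ A`; it lies in `A`. -/
def blockRight (C A : ObsAlg) (c c' : C.ι) : (C.tensor A).alg →ₗ[ℂ] A.alg where
  toFun ρ := ⟨Matrix.of fun a a' => ρ.1 (c, a) (c', a'),
    fun a a' h => ρ.2 (c, a) (c', a') fun e => h (congrArg Prod.snd e)⟩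
  map_add' _ _ := rfl
  map_smul' _ _ := rfl

theorem blockRight_eq_zero {C A : ObsAlg} {c c' : C.ι} (h : C.label c ≠ C.label c')
    (ρ : (C.tensor A).alg) : blockRight C A c c' ρ = 0 := by
  apply Subtype.ext
  ext a a'
  exact ρ.2 (c, a) (c', a') fun e => h (congrArg Prod.fst e)

/-- `T ⊗ id_C`: apply `T` to every block. -/
def ampRight {A B : ObsAlg} (T : A.alg →ₗ[ℂ] B.alg) (C : ObsAlg) :
    (A.tensor C).alg →ₗ[ℂ] (B.tensor C).alg where
  toFun ρ := ⟨Matrix.of fun p q => (T (blockLeft A C p.2 q.2 ρ)).1 p.1 q.1, by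
    rintro ⟨b, c⟩ ⟨b', c'⟩ h
    by_cases hc : C.label c = C.label c'
    · exact (T _).2 b b' fun hb => h (Prod.ext hb hc)
    · simp [blockLeft_eq_zero hc]⟩
  map_add' ρ τ := by
    apply Subtype.ext
    ext p q
    simp
  map_smul' z ρ := by
    apply Subtype.ext
    ext p q
    simp

/-- `id_C ⊗ T`: apply `T` to every block. -/
def ampLeft (C : ObsAlg) {A B : ObsAlg} (T : A.alg →ₗ[ℂ] B.alg) :
    (C.tensor A).alg →ₗ[ℂ] (C.tensor B).alg where
  toFun ρ := ⟨Matrix.of fun p q => (T (blockRight C A p.1 q.1 ρ)).1 p.2 q.2, by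
    rintro ⟨c, b⟩ ⟨c', b'⟩ h
    by_cases hc : C.label c = C.label c'
    · exact (T _).2 b b' fun hb => h (Prod.ext hc hb)
    · simp [blockRight_eq_zero hc]⟩
  map_add' ρ τ := by
    apply Subtype.ext
    ext p q
    simp
  map_smul' z ρ := by
    apply Subtype.ext
    ext p q
    simp

/-- The canonical identification `(A ⊗ B) ⊗ C → A ⊗ (B ⊗ C)`. -/
def assoc (A B C : ObsAlg) :
    ((A.tensor B).tensor C).alg →ₗ[ℂ] (A.tensor (B.tensor C)).alg where
  toFun ρ := ⟨Matrix.of fun p q => ρ.1 ((p.1, p.2.1), p.2.2) ((q.1, q.2.1), q.2.2), by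
    rintro ⟨a, b, c⟩ ⟨a', b', c'⟩ h
    refine ρ.2 _ _ fun e => h ?_
    simp only [Prod.map_apply, Prod.mk.injEq] at e ⊢
    exact ⟨e.1.1, e.1.2, e.2⟩⟩
  map_add' _ _ := rfl
  map_smul' _ _ := rfl

/-- The canonical identification `A ⊗ (B ⊗ C) → (A ⊗ B) ⊗ C`. -/
def assocInv (A B C : ObsAlg) :
    (A.tensor (B.tensor C)).alg →ₗ[ℂ] ((A.tensor B).tensor C).alg where
  toFun ρ := ⟨Matrix.of fun p q => ρ.1 (p.1.1, p.1.2, p.2) (q.1.1, q.1.2, q.2), by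
    rintro ⟨⟨a, b⟩, c⟩ ⟨⟨a', b'⟩, c'⟩ h
    refine ρ.2 _ _ fun e => h ?_
    simp only [Prod.map_apply, Prod.mk.injEq] at e ⊢
    exact ⟨⟨e.1, e.2.1⟩, e.2.2⟩⟩
  map_add' _ _ := rfl
  map_smul' _ _ := rfl

end ObsAlg

/-- A state of the system described by `A`: a density operator in `A`. -/
structure State (A : ObsAlg) where
  op : Matrix A.ι A.ι ℂ
  mem : op ∈ A.alg
  posSemidef : op.PosSemidef
  trace_eq_one : op.trace = 1

/-- Complete positivity: `T ⊗ id_n` preserves positivity for every matrix size `n`. -/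
def IsCompletelyPositive {A B : ObsAlg} (T : A.alg →ₗ[ℂ] B.alg) : Prop :=
  ∀ (n : ℕ) (ρ : (A.tensor (ObsAlg.quantum (Fin n))).alg),
    ρ.1.PosSemidef → (ObsAlg.ampRight T (ObsAlg.quantum (Fin n)) ρ).1.PosSemidef

/-- A channel in the Schrödinger picture: completely positive and trace preserving. -/
structure Channel (A B : ObsAlg) where
  map : A.alg →ₗ[ℂ] B.alg
  cp : IsCompletelyPositive map
  tp : ∀ ρ : A.alg, (map ρ).1.trace = ρ.1.trace

/-- The outcomes `0`, `1` and `∅` (failure). -/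
inductive Outcome where
  | zero
  | one
  | fail
  deriving DecidableEq

instance : Fintype Outcome where
  elems := {Outcome.zero, Outcome.one, Outcome.fail}
  complete := by
    intro x
    cases x <;> simp

/-- An observable with the three possible outcomes: a positive operator valued measure in `A`. -/
structure POVM (A : ObsAlg) where
  op : Outcome → Matrix A.ι A.ι ℂ
  mem : ∀ x, op x ∈ A.alg
  posSemidef : ∀ x, (op x).PosSemidef
  sum_eq_one : ∑ x, op x = 1

/-- Alice's strategies in a game with `2 * m` rounds, notepad `A` and mailbox `M`. -/
structure AliceStrategy (A M : ObsAlg) (m : ℕ) where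
  init : State (A.tensor M)
  step : Fin m → Channel (A.tensor M) (A.tensor M)
  meas : POVM A

/-- Bob's strategies in a game with `2 * m` rounds, notepad `B` and mailbox `M`. -/
structure BobStrategy (B M : ObsAlg) (m : ℕ) where
  init : State B
  step : Fin m → Channel (M.tensor B) (M.tensor B)
  meas : POVM B

variable {A B M : ObsAlg} {m : ℕ}

/-- The initial state `ρ_A ⊗ ρ_B` of the composite system `(A ⊗ M) ⊗ B`. -/
def initialState (σA : AliceStrategy A M m) (σB : BobStrategy B M m) :
    ((A.tensor M).tensor B).alg :=
  ⟨σA.init.op ⊗ₖ σB.init.op, ObsAlg.kronecker_mem σA.init.mem σB.init.mem⟩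

/-- The final state: in each of the `m` double rounds Bob applies `id_A ⊗ T_B` first, then Alice
applies `T_A ⊗ id_B`. -/
def finalState (σA : AliceStrategy A M m) (σB : BobStrategy B M m) :
    ((A.tensor M).tensor B).alg :=
  Fin.foldl m
    (fun ρ j =>
      ObsAlg.ampRight (σA.step j).map B
        (ObsAlg.assocInv A M B (ObsAlg.ampLeft A (σB.step j).map (ObsAlg.assoc A M B ρ))))
    (initialState σA σB)

/-- The probability that Alice obtains `x` and Bob obtains `y`,
`tr[(E_A^x ⊗ 1 ⊗ E_B^y) ρ]` with the final state `ρ`. (As a trace it is a complex number.) -/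
def prob (σA : AliceStrategy A M m) (σB : BobStrategy B M m) (x y : Outcome) : ℂ :=
  Matrix.trace
    (((σA.meas.op x ⊗ₖ (1 : Matrix M.ι M.ι ℂ)) ⊗ₖ σB.meas.op y) * (finalState σA σB).1)

/-- The state is pure: `|ψ⟩⟨ψ|` with a unit vector `ψ`. -/
def State.IsPure (ρ : State A) : Prop :=
  ∃ ψ : EuclideanSpace ℂ A.ι, ‖ψ‖ = 1 ∧ ρ.op = Matrix.of fun i j => ψ i * star (ψ j)

/-- The channel is unitarily implemented: `ρ ↦ U ρ U*`. -/
def Channel.IsUnitary (T : Channel A A) : Prop :=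
  ∃ U ∈ Matrix.unitaryGroup A.ι ℂ, ∀ ρ : A.alg, (T.map ρ).1 = U * ρ.1 * star U

/-- The observable is projection valued. -/
def POVM.IsProjectionValued (E : POVM A) : Prop :=
  ∀ x, IsStarProjection (E.op x)

/-- Alice's unitary strategies. -/
structure AliceStrategy.IsUnitary (σ : AliceStrategy A M m) : Prop where
  quantum_notepad : A.IsQuantum
  quantum_mailbox : M.IsQuantum
  init_pure : σ.init.IsPure
  step_unitary : ∀ j, (σ.step j).IsUnitary
  meas_projection : σ.meas.IsProjectionValued

/-- Bob's unitary strategies. -/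
structure BobStrategy.IsUnitary (σ : BobStrategy B M m) : Prop where
  quantum_notepad : B.IsQuantum
  quantum_mailbox : M.IsQuantum
  init_pure : σ.init.IsPure
  step_unitary : ∀ j, (σ.step j).IsUnitary
  meas_projection : σ.meas.IsProjectionValued

/-- `τ` is the strategy `σ`, with operations extended from `A ⊗ M` to `A ⊗ B(H_M)`. -/
structure AliceStrategy.Extends (τ : AliceStrategy A M.full m) (σ : AliceStrategy A M m) :
    Prop where
  init_eq : τ.init.op = σ.init.op
  step_eq : ∀ (j : Fin m) (ρ' : (A.tensor M.full).alg) (ρ : (A.tensor M).alg),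
    ρ'.1 = ρ.1 → ((τ.step j).map ρ').1 = ((σ.step j).map ρ).1
  meas_eq : τ.meas = σ.meas

/-- `τ` is the strategy `σ`, with operations extended from `M ⊗ B` to `B(H_M) ⊗ B`. -/
structure BobStrategy.Extends (τ : BobStrategy B M.full m) (σ : BobStrategy B M m) :
    Prop where
  init_eq : τ.init = σ.init
  step_eq : ∀ (j : Fin m) (ρ' : (M.full.tensor B).alg) (ρ : (M.tensor B).alg),
    ρ'.1 = ρ.1 → ((τ.step j).map ρ').1 = ((σ.step j).map ρ).1
  meas_eq : τ.meas = σ.meas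

end CoinToss

/-! Each party can defer all randomness and all loss of information to a private register that
nobody else touches. The register has a slot for the purification of the initial state, one fresh
slot per own move for the environment of that operation, and a slot for the measurement outcome. An
operation with Kraus operators `K k` becomes the isometry that applies `K k` and writes `k` into the
next fresh slot. It is only prescribed on register values where that slot is fresh, and is completed
to a unitary arbitrarily.

The invariant `Reduces` says that the dilated state lives on the register values that are still
fresh enough, and that tracing out the register gives the original state. A move of the dilating
party preserves it (`Reduces.conj`). A move of the opponent preserves it because it acts trivially
on the register, so it commutes with the partial trace (`AliceReduces.bob_step`,
`BobReduces.alice_step`). Naimark's projections agree with the original measurement on the reachable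
register values, so the probabilities coincide.

For a restricted mailbox, Kraus operators are taken for the operation composed with the pinching
onto the algebra. After the partial trace the state lies in the original algebra, so the choice of
extension of the opponent's strategy never matters. -/

namespace CoinToss

open Matrix

/-! ### Unitary, pure and projective dilations with a register -/

section Dilation

open scoped MatrixOrder in
theorem exists_eq_conjTranspose_mul_self {n : Type*} [Fintype n] [DecidableEq n]
    {E : Matrix n n ℂ} (hE : E.PosSemidef) : ∃ R : Matrix n n ℂ, E = Rᴴ * R :=
  CStarAlgebra.nonneg_iff_eq_star_mul_self.mp hE.nonneg

theorem sum_rotate {α β γ : Type*} [Fintype α] [Fintype β] [Fintype γ] (F : α → β → γ → ℂ) :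
    ∑ a, ∑ b, ∑ c, F a b c = ∑ b, ∑ c, ∑ a, F a b c :=
  Finset.sum_comm.trans (Finset.sum_congr rfl fun _ _ => Finset.sum_comm)

variable {I D κ : Type} [Fintype I] [Fintype D] [Fintype κ]

/-- Square matrices with prescribed orthonormal columns can be completed to unitaries. -/
theorem exists_unitary_of_columns [DecidableEq I] (W : Matrix I I ℂ) (s : Set I)
    (h : ∀ i ∈ s, ∀ j ∈ s, ∑ k, star (W k i) * W k j = if i = j then 1 else 0) :
    ∃ U ∈ unitaryGroup I ℂ, ∀ j ∈ s, ∀ i, U i j = W i j := by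
  let v : I → EuclideanSpace ℂ I := fun j => WithLp.toLp 2 fun i => W i j
  have hv : Orthonormal ℂ (s.domRestrict v) := by
    classical
    rw [orthonormal_iff_ite]
    rintro ⟨i, hi⟩ ⟨j, hj⟩
    have := h i hi j hj
    simp only [v, EuclideanSpace.inner_eq_star_dotProduct, dotProduct,
      Pi.star_apply, Subtype.mk.injEq]
    rw [← this]
    exact Finset.sum_congr rfl fun k _ => mul_comm _ _
  -- The given columns are extended to an orthonormal basis indexed by all of `I`, whose vectors are
  -- the columns of `U`.
  obtain ⟨b, hb⟩ := hv.exists_orthonormalBasis_extension_of_card_eq (by simp)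
  refine ⟨of fun i j => b j i, ?_, fun j hj i => by simp [hb j hj, v]⟩
  rw [mem_unitaryGroup_iff']
  ext i j
  have := orthonormal_iff_ite.mp b.orthonormal i j
  simp only [EuclideanSpace.inner_eq_star_dotProduct, dotProduct, Pi.star_apply] at this
  rw [one_apply, ← this, star_eq_conjTranspose, mul_apply]
  exact Finset.sum_congr rfl fun k _ => mul_comm _ _

/-- A register value `c` determines both the Kraus index and the previous register value, so cross
terms vanish. This one computation gives the orthonormality of the dilation's columns, the partial
trace after a move, and the compression of Naimark's projections. -/
theorem sum_ite_mul_sum_ite [DecidableEq D] {S : Set D} {f : κ × D → D}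
    (hf : Set.InjOn f (Set.univ ×ˢ S)) (a b : κ → ℂ) {d e : D} (hd : d ∈ S) (he : e ∈ S) :
    ∑ c, (∑ k, if f (k, d) = c then a k else 0) * (∑ k, if f (k, e) = c then b k else 0) =
      if d = e then ∑ k, a k * b k else 0 := by
  classical
  have key : ∀ k l, f (l, e) = f (k, d) ↔ l = k ∧ e = d := fun k l =>
    ⟨fun h => Prod.ext_iff.mp (hf ⟨trivial, he⟩ ⟨trivial, hd⟩ h), fun h => by rw [h.1, h.2]⟩
  simp_rw [Finset.sum_mul_sum, ite_mul, zero_mul, mul_ite, mul_zero]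
  rw [sum_rotate]
  split_ifs with h
  · subst h
    refine Finset.sum_congr rfl fun k _ => ?_
    rw [Finset.sum_eq_single k]
    · simp
    · intro l _ hl
      simp [key, hl]
    · simp
  · simp [key, Ne.symm h]

/-- The column of the dilation of `∑ K ρ K*` in which the register moves from `d` to `f (k, d)`. -/
def dilation [DecidableEq D] (K : κ → Matrix I I ℂ) (f : κ × D → D) :
    Matrix (I × D) (I × D) ℂ :=
  of fun p q => ∑ k, if f (k, q.2) = p.2 then K k p.1 q.1 else 0

/-- Stinespring: injectivity of `f` on `S` and the normalization of the `K k` make the columns over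
`S` orthonormal. The remaining columns are irrelevant, since the states concerned are supported on
`S`. -/
theorem exists_unitary_dilation [DecidableEq I] [DecidableEq D] (K : κ → Matrix I I ℂ) (hK : ∑ k, (K k)ᴴ * K k = 1)
    {S : Set D} {f : κ × D → D} (hf : Set.InjOn f (Set.univ ×ˢ S)) :
    ∃ U ∈ unitaryGroup (I × D) ℂ, ∀ q : I × D, q.2 ∈ S → ∀ p, U p q = dilation K f p q := by
  refine exists_unitary_of_columns _ {q : I × D | q.2 ∈ S} ?_
  rintro ⟨i, d⟩ hd ⟨j, e⟩ he
  have := congrFun₂ hK i j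
  simp only [Matrix.sum_apply, mul_apply, conjTranspose_apply, one_apply] at this
  simp only [dilation, of_apply, Fintype.sum_prod_type, star_sum, apply_ite star, star_zero]
  simp_rw [sum_ite_mul_sum_ite hf _ _ (show d ∈ S from hd) (show e ∈ S from he)]
  by_cases h : d = e
  · simp only [h, if_true, Prod.mk.injEq, and_true]
    rw [Finset.sum_comm, this]
  · simp [h]

/-- `ρ'` is supported on the register values in `S`, and its partial trace over the register
is `ρ`. -/
structure Reduces (S : Set D) (ρ' : Matrix (I × D) (I × D) ℂ) (ρ : Matrix I I ℂ) : Prop where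
  left : ∀ p q, p.2 ∉ S → ρ' p q = 0
  right : ∀ p q, q.2 ∉ S → ρ' p q = 0
  sum_eq : ∀ i i', ∑ d, ρ' (i, d) (i', d) = ρ i i'

/-- Summation against a kernel that is diagonal on `S`. -/
theorem Reduces.sum_kernel [DecidableEq D] {S : Set D} {ρ' : Matrix (I × D) (I × D) ℂ} {ρ : Matrix I I ℂ}
    (h : Reduces S ρ' ρ) (G : I × D → I × D → ℂ) (g : I → I → ℂ)
    (hG : ∀ p q : I × D, p.2 ∈ S → q.2 ∈ S → G p q = if p.2 = q.2 then g p.1 q.1 else 0) :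
    ∑ p, ∑ q, G p q * ρ' p q = ∑ i, ∑ j, g i j * ρ i j := by
  -- Outside `S` the kernel is unknown but `ρ'` vanishes. Coherences of `ρ'` between different
  -- register values are killed by the diagonal kernel.
  have h1 : ∀ p q, G p q * ρ' p q = (if p.2 = q.2 then g p.1 q.1 else 0) * ρ' p q := by
    intro p q
    by_cases hp : p.2 ∈ S
    · by_cases hq : q.2 ∈ S
      · rw [hG p q hp hq]
      · rw [h.right _ _ hq, mul_zero, mul_zero]
    · rw [h.left _ _ hp, mul_zero, mul_zero]
  simp_rw [h1, Fintype.sum_prod_type, ite_mul, zero_mul, Finset.sum_ite_eq, Finset.mem_univ,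
    if_true, ← h.sum_eq, Finset.mul_sum]
  exact Finset.sum_congr rfl fun i _ => Finset.sum_comm

/-- The partial trace after conjugation is a sum of `ρ'` against the kernel `∑ d, U (i, d) p * star
(U (i', d) q)`, which is diagonal in the register on `S`. Hence only the partial trace of `ρ'`
enters. -/
theorem Reduces.conj [DecidableEq D] {S S' : Set D} {ρ' : Matrix (I × D) (I × D) ℂ} {ρ : Matrix I I ℂ}
    (h : Reduces S ρ' ρ) {K : κ → Matrix I I ℂ} {f : κ × D → D}
    (hf : Set.InjOn f (Set.univ ×ˢ S)) (hS : Set.MapsTo f (Set.univ ×ˢ S) S')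
    {U : Matrix (I × D) (I × D) ℂ}
    (hU : ∀ q : I × D, q.2 ∈ S → ∀ p, U p q = dilation K f p q) :
    Reduces S' (U * ρ' * Uᴴ) (∑ k, K k * ρ * (K k)ᴴ) := by
  have hUρ : ∀ p q, p.2 ∉ S' → (U * ρ') p q = 0 := by
    intro p q hp
    rw [mul_apply]
    refine Finset.sum_eq_zero fun r _ => ?_
    by_cases hr : r.2 ∈ S
    · rw [hU r hr, dilation, of_apply, Finset.sum_eq_zero, zero_mul]
      intro k _
      exact if_neg fun e => hp (by rw [← e]; exact hS ⟨trivial, hr⟩)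
    · rw [h.left _ _ hr, mul_zero]
  have hρU : ∀ p q, q.2 ∉ S' → (ρ' * Uᴴ) p q = 0 := by
    intro p q hq
    rw [mul_apply]
    refine Finset.sum_eq_zero fun r _ => ?_
    by_cases hr : r.2 ∈ S
    · rw [conjTranspose_apply, hU r hr, dilation, of_apply, Finset.sum_eq_zero, star_zero,
        mul_zero]
      intro k _
      exact if_neg fun e => hq (by rw [← e]; exact hS ⟨trivial, hr⟩)
    · rw [h.right _ _ hr, zero_mul]
  refine ⟨fun p q hp => ?_, fun p q hq => ?_, fun i i' => ?_⟩
  · rw [mul_apply]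
    exact Finset.sum_eq_zero fun r _ => by rw [hUρ _ _ hp, zero_mul]
  · rw [Matrix.mul_assoc, mul_apply]
    exact Finset.sum_eq_zero fun r _ => by rw [hρU _ _ hq, mul_zero]
  · have e1 : ∀ d, (U * ρ' * Uᴴ) (i, d) (i', d) =
        ∑ p, ∑ q, U (i, d) p * star (U (i', d) q) * ρ' p q := by
      intro d
      simp only [mul_apply, conjTranspose_apply, Finset.sum_mul]
      rw [Finset.sum_comm]
      exact Finset.sum_congr rfl fun p _ => Finset.sum_congr rfl fun q _ => by ring
    simp_rw [e1]
    rw [sum_rotate]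
    simp_rw [← Finset.sum_mul]
    rw [h.sum_kernel (fun p q => ∑ d, U (i, d) p * star (U (i', d) q))
      (fun j j' => ∑ k, K k i j * star (K k i' j'))]
    · simp only [Matrix.sum_apply, mul_apply, conjTranspose_apply, Finset.sum_mul]
      rw [← sum_rotate]
      refine Finset.sum_congr rfl fun k _ => ?_
      rw [Finset.sum_comm]
      refine Finset.sum_congr rfl fun j _ => Finset.sum_congr rfl fun j' _ => by ring
    · rintro ⟨j, e⟩ ⟨j', e'⟩ he he'
      simp_rw [hU _ he, hU _ he', dilation, of_apply, star_sum, apply_ite star, star_zero]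
      exact sum_ite_mul_sum_ite hf _ _ he he'

omit [Fintype I] in
theorem Reduces.smul {S : Set D} {ρ' : Matrix (I × D) (I × D) ℂ} {ρ : Matrix I I ℂ}
    (h : Reduces S ρ' ρ) (c : ℂ) : Reduces S (c • ρ') (c • ρ) :=
  ⟨fun p q hp => by simp [h.left p q hp], fun p q hq => by simp [h.right p q hq],
    fun i i' => by simp [← h.sum_eq, Finset.mul_sum]⟩

/-- Purification. -/
theorem exists_purification [DecidableEq I] [DecidableEq D] {ρ : Matrix I I ℂ} (hρ : ρ.PosSemidef) {S : Set D} {f : I → D}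
    (hf : Function.Injective f) (hS : ∀ i, f i ∈ S) :
    ∃ ψ : I × D → ℂ, Reduces S (of fun p q => ψ p * star (ψ q)) ρ := by
  obtain ⟨R, rfl⟩ := exists_eq_conjTranspose_mul_self hρ
  -- With `ρ = Rᴴ * R`, the conjugated row `r` of `R` is attached to the register value `f r`.
  refine ⟨fun p => ∑ r, if f r = p.2 then star (R r p.1) else 0, ?_, ?_, ?_⟩
  · intro p q hp
    have : ∀ r, f r ≠ p.2 := fun r e => hp (e ▸ hS r)
    simp [this]
  · intro p q hp
    have : ∀ r, f r ≠ q.2 := fun r e => hp (e ▸ hS r)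
    simp [this]
  · intro i i'
    simp only [of_apply, star_sum, apply_ite star, star_star, star_zero, mul_apply,
      conjTranspose_apply, Finset.sum_mul_sum, ite_mul, zero_mul, mul_ite, mul_zero]
    rw [Finset.sum_comm]
    refine Finset.sum_congr rfl fun r _ => ?_
    rw [Finset.sum_comm, Finset.sum_eq_single r]
    · simp
    · intro l _ hl
      simp [hf.eq_iff, Ne.symm hl]
    · simp

/-- Naimark dilation of a positive operator valued measure; `color` reads the outcome off the
register. -/
theorem exists_projective_dilation [DecidableEq I] [DecidableEq D] [DecidableEq κ] (E : κ → Matrix I I ℂ)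
    (hE : ∀ k, (E k).PosSemidef) (hsum : ∑ k, E k = 1) {S : Set D} {f : κ × D → D}
    (hf : Set.InjOn f (Set.univ ×ˢ S)) (color : D → κ)
    (hcolor : ∀ k, ∀ d ∈ S, color (f (k, d)) = k) :
    ∃ F : κ → Matrix (I × D) (I × D) ℂ, (∀ k, IsStarProjection (F k)) ∧ ∑ k, F k = 1 ∧
      ∀ k (p q : I × D), p.2 ∈ S → q.2 ∈ S →
        F k p q = if p.2 = q.2 then E k p.1 q.1 else 0 := by
  choose K hK using fun k => exists_eq_conjTranspose_mul_self (hE k)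
  obtain ⟨U, hU, hUK⟩ := exists_unitary_dilation K (by simp_rw [← hK, hsum]) hf
  -- Reading off the colour after applying `U` measures the register. As `color` is defined
  -- everywhere, the projections sum to one on the whole space and not only over `S`.
  let P : κ → Matrix (I × D) (I × D) ℂ := fun k =>
    diagonal fun p => if color p.2 = k then 1 else 0
  have hUU : U * Uᴴ = 1 := mem_unitaryGroup_iff.mp hU
  have hUU' : Uᴴ * U = 1 := mem_unitaryGroup_iff'.mp hU
  have hPP : ∀ k, P k * P k = P k := fun k => by simp [P]
  refine ⟨fun k => Uᴴ * P k * U, fun k => ⟨?_, ?_⟩, ?_, ?_⟩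
  · change Uᴴ * P k * U * (Uᴴ * P k * U) = Uᴴ * P k * U
    calc _ = Uᴴ * P k * (U * Uᴴ) * P k * U := by simp only [Matrix.mul_assoc]
      _ = _ := by rw [hUU, Matrix.mul_one, Matrix.mul_assoc Uᴴ, hPP]
  · change (Uᴴ * P k * U)ᴴ = _
    have : (P k)ᴴ = P k := by
      simp only [P, diagonal_conjTranspose]
      congr 1
      ext p
      simp [apply_ite star]
    simp [this, Matrix.mul_assoc]
  · have : ∑ k, P k = 1 := by
      ext p q
      simp [P, Matrix.sum_apply, diagonal_apply, one_apply]
    rw [← Finset.sum_mul, ← Finset.mul_sum, this, Matrix.mul_one, hUU']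
  · rintro x ⟨i, d⟩ ⟨j, e⟩ hd he
    have h1 : ∀ p : I × D, ∀ q : I × D, q.2 ∈ S → (P x * U) p q =
        ∑ k, if f (k, q.2) = p.2 then (if k = x then K k p.1 q.1 else 0) else 0 := by
      intro p q hq
      rw [diagonal_mul, hUK _ hq, dilation, of_apply, Finset.mul_sum]
      refine Finset.sum_congr rfl fun k _ => ?_
      by_cases h : f (k, q.2) = p.2
      · have hc : color p.2 = k := h ▸ hcolor k _ hq
        simp only [h, hc, if_true, ite_mul, one_mul, zero_mul]
      · simp only [h, if_false, mul_zero]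
    change (Uᴴ * P x * U) (i, d) (j, e) = _
    rw [Matrix.mul_assoc, mul_apply]
    simp_rw [conjTranspose_apply, h1 _ _ he, hUK _ hd, dilation, of_apply,
      Fintype.sum_prod_type, star_sum, apply_ite star, star_zero]
    simp_rw [sum_ite_mul_sum_ite hf _ _ (show d ∈ S from hd) (show e ∈ S from he)]
    simp only [mul_ite, mul_zero, Finset.sum_ite_eq', Finset.mem_univ, if_true]
    rw [hK x, mul_apply]
    split_ifs <;> simp

end Dilation

/-! ### Pinching and Kraus operators for block diagonal algebras -/

section Kraus

variable {A B : ObsAlg}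

namespace ObsAlg

open Classical in
/-- The conditional expectation onto `A`: delete the entries outside the diagonal blocks. -/
noncomputable def pinch (A : ObsAlg) : Matrix A.ι A.ι ℂ →ₗ[ℂ] A.alg where
  toFun ρ := ⟨of fun i j => if A.label i = A.label j then ρ i j else 0, fun i j h => by simp [h]⟩
  map_add' ρ τ := by
    apply Subtype.ext
    ext i j
    simp only [of_apply, Matrix.add_apply, Submodule.coe_add]
    split_ifs <;> simp
  map_smul' c ρ := by
    apply Subtype.ext
    ext i j
    simp

theorem pinch_apply (ρ : Matrix A.ι A.ι ℂ) (i j : A.ι) [Decidable (A.label i = A.label j)] :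
    (A.pinch ρ).1 i j = if A.label i = A.label j then ρ i j else 0 := by
  simp only [pinch, LinearMap.coe_mk, AddHom.coe_mk, of_apply]
  congr

theorem blockLeft_apply (A C : ObsAlg) (c c' : C.ι) (ρ : (A.tensor C).alg) (a a' : A.ι) :
    (blockLeft A C c c' ρ).1 a a' = ρ.1 (a, c) (a', c') :=
  rfl

theorem pinch_coe (ρ : A.alg) : A.pinch ρ.1 = ρ := by
  apply Subtype.ext
  ext i j
  by_cases h : A.label i = A.label j
  · simp [pinch, h]
  · simp [pinch, h, ρ.2 i j h]

theorem trace_pinch (ρ : Matrix A.ι A.ι ℂ) : (A.pinch ρ).1.trace = ρ.trace := by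
  simp [pinch, trace]

end ObsAlg

/-- Choi's theorem for `T` composed with the pinching, which is defined on all matrices. The index
`none`, carrying the zero operator, keeps the index type nonempty even when `A.ι` is empty, as
`exists_register` requires. -/
theorem Channel.exists_kraus (T : Channel A A) :
    ∃ K : Option (A.ι × A.ι) → Matrix A.ι A.ι ℂ, ∑ k, (K k)ᴴ * K k = 1 ∧
      ∀ ρ, (T.map (A.pinch ρ)).1 = ∑ k, K k * ρ * (K k)ᴴ := by
  classical
  let e := Fintype.equivFin A.ι
  -- The unnormalized maximally entangled projector, pinched so that it lies in the algebra. It is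
  -- positive as a sum of rank one operators, one for each classical value.
  let Ω : ((A.tensor (ObsAlg.quantum (Fin (Fintype.card A.ι)))).alg) :=
    ⟨of fun p q => if A.label p.1 = A.label q.1 ∧ e p.1 = p.2 ∧ e q.1 = q.2 then 1 else 0, by
      rintro ⟨i, k⟩ ⟨j, l⟩ h
      have : A.label i ≠ A.label j := fun e => h (Prod.ext e rfl)
      simp [this]⟩
  have hΩ : Ω.1.PosSemidef := by
    have : Fintype (Set.range A.label) := Fintype.ofFinite _
    let V : Matrix (Set.range A.label) (A.ι × Fin (Fintype.card A.ι)) ℂ :=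
      of fun x p => if A.label p.1 = x ∧ e p.1 = p.2 then 1 else 0
    have hV : Ω.1 = Vᴴ * V := by
      ext p q
      rw [mul_apply, Finset.sum_eq_single ⟨A.label p.1, Set.mem_range_self _⟩]
      · simp only [Ω, V, of_apply, conjTranspose_apply]
        by_cases h1 : A.label p.1 = A.label q.1 <;> by_cases h2 : e p.1 = p.2 <;>
          by_cases h3 : e q.1 = q.2 <;> simp [h1, h2, h3, Ne.symm]
      · rintro ⟨x, hx⟩ _ hne
        have : A.label p.1 ≠ x := fun e => hne (Subtype.ext e.symm)
        simp [V, this]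
      · simp
    rw [hV]
    exact posSemidef_conjTranspose_mul_self V
  have hC := (T.cp _ Ω hΩ).submatrix
    (fun p : A.ι × A.ι => ((p.1, e p.2) : A.ι × Fin (Fintype.card A.ι)))
  obtain ⟨R, hR⟩ := exists_eq_conjTranspose_mul_self hC
  have hblock : ∀ k l, ObsAlg.blockLeft A (ObsAlg.quantum (Fin (Fintype.card A.ι))) (e k) (e l) Ω =
      A.pinch (single k l 1) := by
    intro k l
    apply Subtype.ext
    ext i j
    rw [ObsAlg.blockLeft_apply, ObsAlg.pinch_apply]
    simp only [Ω, of_apply, e.injective.eq_iff, single_apply]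
    by_cases h1 : A.label i = A.label j <;> by_cases h2 : i = k <;> by_cases h3 : j = l <;>
      simp_all [eq_comm]
  have hT : ∀ i j k l, (T.map (A.pinch (single k l 1))).1 i j =
      ∑ r, star (R r (i, k)) * R r (j, l) := by
    intro i j k l
    have := congrFun₂ hR (i, k) (j, l)
    rw [mul_apply] at this
    rw [← hblock]
    exact this
  -- Each row of the root `R` of the Choi matrix, conjugated and reshaped, is a Kraus operator.
  let K : Option (A.ι × A.ι) → Matrix A.ι A.ι ℂ := fun k =>
    k.elim 0 fun r => of fun i k => star (R r (i, k))
  refine ⟨K, ?_, fun ρ => ?_⟩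
  · ext k l
    have h1 := T.tp (A.pinch (single l k 1))
    rw [ObsAlg.trace_pinch] at h1
    have h2 : (single l k (1 : ℂ)).trace = if k = l then 1 else 0 := by
      split_ifs with h
      · subst h
        simp
      · exact trace_single_eq_of_ne _ _ _ (Ne.symm h)
    rw [h2, trace] at h1
    simp only [diag_apply, hT] at h1
    rw [one_apply, ← h1, Fintype.sum_option, Finset.sum_comm]
    simp only [K, Option.elim_none, Option.elim_some, Matrix.mul_zero, zero_add,
      Matrix.sum_apply, mul_apply, conjTranspose_apply, of_apply, star_star]
    exact Finset.sum_congr rfl fun r _ => Finset.sum_congr rfl fun i _ => mul_comm _ _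
  · have hρ : A.pinch ρ = ∑ k, ∑ l, ρ k l • A.pinch (single k l 1) := by
      conv_lhs => rw [matrix_eq_sum_single ρ]
      simp_rw [map_sum, ← map_smul, smul_single, smul_eq_mul, mul_one]
    rw [hρ]
    ext i j
    simp only [map_sum, map_smul, Submodule.coe_sum, Submodule.coe_smul, Matrix.sum_apply,
      Matrix.smul_apply, hT, smul_eq_mul]
    rw [Fintype.sum_option, show K none = 0 from rfl, Matrix.zero_mul, Matrix.zero_mul,
      Matrix.zero_apply, zero_add]
    simp only [K, Option.elim_some, mul_apply, conjTranspose_apply, of_apply, star_star, Finset.mul_sum,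
      Finset.sum_mul]
    rw [← sum_rotate]
    refine Finset.sum_congr rfl fun r _ => ?_
    rw [Finset.sum_comm]
    exact Finset.sum_congr rfl fun k _ => Finset.sum_congr rfl fun l _ => by ring

/-- The channel `ρ ↦ ∑ K ρ K*`. -/
def Channel.ofKraus {κ : Type} [Fintype κ] (K : κ → Matrix B.ι A.ι ℂ)
    (hK : ∑ k, (K k)ᴴ * K k = 1) (hmem : ∀ ρ ∈ A.alg, ∑ k, K k * ρ * (K k)ᴴ ∈ B.alg) :
    Channel A B where
  map :=
    { toFun := fun ρ => ⟨∑ k, K k * ρ.1 * (K k)ᴴ, hmem ρ.1 ρ.2⟩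
      map_add' := fun ρ τ => Subtype.ext <| by
        simp [Matrix.mul_add, Matrix.add_mul, Finset.sum_add_distrib]
      map_smul' := fun c ρ => Subtype.ext <| by
        simp [Finset.smul_sum] }
  cp n ρ hρ := by
    have h : ∀ k, ((K k ⊗ₖ (1 : Matrix (Fin n) (Fin n) ℂ)) * ρ.1 *
        (K k ⊗ₖ (1 : Matrix (Fin n) (Fin n) ℂ))ᴴ).PosSemidef :=
      fun k => hρ.mul_mul_conjTranspose_same _
    convert posSemidef_sum Finset.univ fun k _ => h k
    ext ⟨i, c⟩ ⟨j, d⟩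
    change (∑ k, K k * (ObsAlg.blockLeft A _ c d ρ).1 * (K k)ᴴ) i j = _
    simp only [Matrix.sum_apply]
    refine Finset.sum_congr rfl fun k _ => ?_
    simp [mul_apply, kroneckerMap_apply, conjTranspose_apply, one_apply, Fintype.sum_prod_type,
      apply_ite star]
    rfl
  tp ρ := by
    change (∑ k, K k * ρ.1 * (K k)ᴴ).trace = _
    simp_rw [trace_sum, fun k => trace_mul_comm (K k * ρ.1) (K k)ᴴ, ← Matrix.mul_assoc,
      ← trace_sum, ← Finset.sum_mul, hK, Matrix.one_mul]


end Kraus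

/-! ### Induction over the rounds and the register -/

section Bookkeeping

theorem foldl_induction₂ {α β : Type*} : ∀ (m : ℕ) (P : ℕ → α → β → Prop) (f : α → Fin m → α)
    (g : β → Fin m → β) (a : α) (b : β), P 0 a b →
    (∀ (j : Fin m) x y, P j x y → P (j + 1) (f x j) (g y j)) →
    P m (Fin.foldl m f a) (Fin.foldl m g b)
  | 0, _, _, _, _, _, h0, _ => by simpa using h0
  | m + 1, P, f, g, a, b, h0, h => by
    rw [Fin.foldl_succ_last, Fin.foldl_succ_last]
    refine h (Fin.last m) _ _ ?_
    exact foldl_induction₂ m P _ _ a b h0 fun j x y hxy => h j.castSucc x y hxy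

/-- A register with room for a purification, `m` environments and a measurement outcome. -/
theorem exists_register (R κ O : Type) [Fintype R] [Fintype κ] [Fintype O] [Nonempty κ]
    [Nonempty O] (m : ℕ) :
    ∃ (d : ℕ) (S : ℕ → Set (Fin d)) (init : R → Fin d) (step : Fin m → κ × Fin d → Fin d)
      (final : O × Fin d → Fin d) (color : Fin d → O),
      Function.Injective init ∧ (∀ r, init r ∈ S 0) ∧
      (∀ j : Fin m, Set.InjOn (step j) (Set.univ ×ˢ S j) ∧
        Set.MapsTo (step j) (Set.univ ×ˢ S j) (S (j + 1))) ∧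
      Set.InjOn final (Set.univ ×ˢ S m) ∧ ∀ x, ∀ d ∈ S m, color (final (x, d)) = x := by
  classical
  obtain ⟨k₀⟩ := ‹Nonempty κ›
  obtain ⟨o₀⟩ := ‹Nonempty O›
  let e := Fintype.equivFin ((R × (Fin m → κ)) × O)
  -- At stage `j` the outcome slot and the environment slots from `j` on still hold their default
  -- values. Move `j` overwrites slot `j`.
  refine ⟨_, fun j => {d | (e.symm d).2 = o₀ ∧
      ∀ i : Fin m, j ≤ i → (e.symm d).1.2 i = k₀},
    fun r => e ((r, fun _ => k₀), o₀),
    fun j p => e (((e.symm p.2).1.1, Function.update (e.symm p.2).1.2 j p.1), (e.symm p.2).2),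
    fun p => e ((e.symm p.2).1, p.1), fun d => (e.symm d).2, ?_, ?_, fun j => ⟨?_, ?_⟩, ?_, ?_⟩
  · intro r s h
    simpa using h
  · intro r
    simp
  · rintro ⟨k, d⟩ ⟨_, hd⟩ ⟨l, d'⟩ ⟨_, hd'⟩ h
    simp only [EmbeddingLike.apply_eq_iff_eq, Prod.mk.injEq] at h
    obtain ⟨⟨h1, h2⟩, h3⟩ := h
    refine Prod.ext (by simpa using congrFun h2 j) (e.symm.injective ?_)
    refine Prod.ext (Prod.ext h1 (funext fun i => ?_)) h3
    -- The old content of the overwritten slot is not lost: on the `j`-th set it is `k₀`.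
    by_cases hi : i = j
    · subst hi
      exact (hd.2 i le_rfl).trans (hd'.2 i le_rfl).symm
    · simpa [hi] using congrFun h2 i
  · rintro ⟨k, d⟩ ⟨_, hd⟩
    refine ⟨by simpa using hd.1, fun i hi => ?_⟩
    have hij : i ≠ j := by
      rintro rfl
      omega
    simpa [hij] using hd.2 i (by omega)
  · rintro ⟨k, d⟩ ⟨_, hd⟩ ⟨l, d'⟩ ⟨_, hd'⟩ h
    simp only [EmbeddingLike.apply_eq_iff_eq, Prod.mk.injEq] at h
    exact Prod.ext h.2 (e.symm.injective (Prod.ext h.1 (hd.1.trans hd'.1.symm)))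
  · intro x d _
    simp

end Bookkeeping

/-- Exchange of the last two factors of a triple product. -/
def prodRightComm (α β γ : Type) : (α × β) × γ ≃ (α × γ) × β where
  toFun p := ((p.1.1, p.2), p.1.2)
  invFun p := ((p.1.1, p.2), p.1.2)

/-! ### States, channels and measurements built from the dilations -/

section Construction

variable {A : ObsAlg}

/-- The new labelling is coarser, so its algebra contains `A.alg`. The extension is pinching
followed by `T`, and the pinching is the identity on `A.alg`. -/
theorem Channel.exists_extension (T : Channel A A) {X : Type} (label : A.ι → X)
    (h : ∀ i j, label i ≠ label j → A.label i ≠ A.label j) :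
    ∃ T' : Channel (ObsAlg.mk A.ι X label) (ObsAlg.mk A.ι X label),
      ∀ (ρ' : (ObsAlg.mk A.ι X label).alg) (ρ : A.alg), ρ'.1 = ρ.1 →
        (T'.map ρ').1 = (T.map ρ).1 := by
  obtain ⟨K, hK, hT⟩ := T.exists_kraus
  refine ⟨Channel.ofKraus K hK fun ρ _ => ?_, fun ρ' ρ hρ => ?_⟩
  · rw [← hT]
    exact fun i j hij => (T.map _).2 i j (h i j hij)
  · change ∑ k, K k * ρ'.1 * (K k)ᴴ = _
    rw [hρ, ← hT, ObsAlg.pinch_coe]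

theorem State.exists_pure (hA : A.IsQuantum) (ψ : A.ι → ℂ) (h : ∑ i, ψ i * star (ψ i) = 1) :
    ∃ ρ : State A, ρ.IsPure ∧ ρ.op = of fun i j => ψ i * star (ψ j) := by
  have hA' : ∀ ρ, ρ ∈ A.alg := fun ρ => hA ▸ Submodule.mem_top
  refine ⟨⟨of fun i j => ψ i * star (ψ j), hA' _, posSemidef_vecMulVec_self_star ψ, h⟩,
    ⟨WithLp.toLp 2 ψ, ?_, rfl⟩, rfl⟩
  rw [EuclideanSpace.norm_eq, Real.sqrt_eq_one]
  apply Complex.ofReal_injective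
  rw [Complex.ofReal_one, ← h, Complex.ofReal_sum]
  exact Finset.sum_congr rfl fun i _ => by
    rw [Complex.ofReal_pow]
    exact (Complex.mul_conj' _).symm

theorem Channel.exists_isUnitary (hA : A.IsQuantum) {U : Matrix A.ι A.ι ℂ}
    (hU : U ∈ unitaryGroup A.ι ℂ) :
    ∃ T : Channel A A, T.IsUnitary ∧ ∀ ρ : A.alg, (T.map ρ).1 = U * ρ.1 * Uᴴ := by
  have hA' : ∀ ρ, ρ ∈ A.alg := fun ρ => hA ▸ Submodule.mem_top
  have hT : ∀ ρ : A.alg, ((Channel.ofKraus (κ := Unit) (A := A) (B := A) (fun _ => U)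
      ((Fintype.sum_unique _).trans (mem_unitaryGroup_iff'.mp hU)) fun _ _ => hA' _).map ρ).1 = U * ρ.1 * Uᴴ :=
    fun ρ => Fintype.sum_unique fun _ : Unit => U * ρ.1 * Uᴴ
  exact ⟨_, ⟨U, hU, hT⟩, hT⟩

theorem POVM.exists_isProjectionValued (hA : A.IsQuantum) {F : Outcome → Matrix A.ι A.ι ℂ}
    (hF : ∀ x, IsStarProjection (F x)) (hsum : ∑ x, F x = 1) :
    ∃ E : POVM A, E.IsProjectionValued ∧ E.op = F := by
  refine ⟨⟨F, fun x => hA ▸ Submodule.mem_top, fun x => ?_, hsum⟩, hF, rfl⟩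
  have h : F x = (F x)ᴴ * F x := by
    have h1 : (F x)ᴴ = F x := (hF x).isSelfAdjoint
    rw [h1]
    exact (hF x).isIdempotentElem.symm
  rw [h]
  exact posSemidef_conjTranspose_mul_self _

theorem submatrix_mem_unitaryGroup {m n : Type*} [Fintype m] [DecidableEq m] [Fintype n]
    [DecidableEq n] {U : Matrix n n ℂ} (hU : U ∈ unitaryGroup n ℂ) (e : m ≃ n) :
    U.submatrix e e ∈ unitaryGroup m ℂ := by
  rw [mem_unitaryGroup_iff, star_eq_conjTranspose] at hU ⊢
  rw [conjTranspose_submatrix, submatrix_mul_equiv, hU, submatrix_one_equiv]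

theorem trace_kronecker_mul {m n : Type*} [Fintype m] [Fintype n] (X : Matrix m m ℂ)
    (Y : Matrix n n ℂ) (ρ : Matrix (m × n) (m × n) ℂ) :
    ((X ⊗ₖ Y) * ρ).trace =
      ∑ c, ∑ c', Y c c' * (X * of fun i j => ρ (i, c') (j, c)).trace := by
  simp only [trace, diag_apply, mul_apply, kroneckerMap_apply, Fintype.sum_prod_type, of_apply,
    Finset.mul_sum]
  rw [Finset.sum_comm]
  refine Finset.sum_congr rfl fun c _ => ?_
  rw [← sum_rotate]
  exact Finset.sum_congr rfl fun _ _ => Finset.sum_congr rfl fun _ _ =>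
    Finset.sum_congr rfl fun _ _ => by ring

theorem trace_kronecker_mul' {m n : Type*} [Fintype m] [Fintype n] (X : Matrix m m ℂ)
    (Y : Matrix n n ℂ) (ρ : Matrix (m × n) (m × n) ℂ) :
    ((X ⊗ₖ Y) * ρ).trace =
      ∑ c, ∑ c', X c c' * (Y * of fun i j => ρ (c', i) (c, j)).trace := by
  simp only [trace, diag_apply, mul_apply, kroneckerMap_apply, Fintype.sum_prod_type, of_apply,
    Finset.mul_sum]
  refine Finset.sum_congr rfl fun c _ => ?_
  rw [Finset.sum_comm]
  exact Finset.sum_congr rfl fun _ _ => Finset.sum_congr rfl fun _ _ =>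
    Finset.sum_congr rfl fun _ _ => by ring

theorem Reduces.trace_mul {I D : Type} [Fintype I] [Fintype D] [DecidableEq D] {S : Set D}
    {ρ' : Matrix (I × D) (I × D) ℂ} {ρ : Matrix I I ℂ} (h : Reduces S ρ' ρ)
    {F : Matrix (I × D) (I × D) ℂ} {E : Matrix I I ℂ}
    (hF : ∀ p q : I × D, p.2 ∈ S → q.2 ∈ S → F p q = if p.2 = q.2 then E p.1 q.1 else 0) :
    (F * ρ').trace = (E * ρ).trace := by
  have := h.sum_kernel (fun p q => F q p) (fun i j => E j i) fun p q hp hq => by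
    rw [hF q p hq hp]
    simp only [eq_comm]
  simp only [trace, diag_apply, mul_apply]
  rw [Finset.sum_comm, this, Finset.sum_comm]

theorem Reduces.trace_eq {I D : Type} [Fintype I] [Fintype D] {S : Set D}
    {ρ' : Matrix (I × D) (I × D) ℂ} {ρ : Matrix I I ℂ} (h : Reduces S ρ' ρ) :
    ρ'.trace = ρ.trace := by
  simp only [trace, diag_apply, Fintype.sum_prod_type, h.sum_eq]

end Construction

/-! ### The invariant through one round and at the final measurement -/

section Game

variable {A B M : ObsAlg} {m d : ℕ}

theorem isQuantum_quantum (H : Type) [Fintype H] [DecidableEq H] :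
    (ObsAlg.quantum H).IsQuantum :=
  eq_top_iff.mpr fun _ _ _ _ h => absurd rfl h

theorem ObsAlg.IsQuantum.tensor (hA : A.IsQuantum) (hB : B.IsQuantum) :
    (A.tensor B).IsQuantum := by
  have hA' : ∀ i j, A.label i = A.label j := fun i j => by
    by_contra h
    -- The all-ones matrix is block diagonal only if all labels agree.
    have : (of fun _ _ => 1 : Matrix A.ι A.ι ℂ) ∈ A.alg := hA ▸ Submodule.mem_top
    exact one_ne_zero (this i j h)
  have hB' : ∀ i j, B.label i = B.label j := fun i j => by
    by_contra h
    have : (of fun _ _ => 1 : Matrix B.ι B.ι ℂ) ∈ B.alg := hB ▸ Submodule.mem_top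
    exact one_ne_zero (this i j h)
  exact eq_top_iff.mpr fun _ _ p q h => absurd (Prod.ext (hA' _ _) (hB' _ _)) h

theorem BobStrategy.exists_extends (σ : BobStrategy B M m) :
    ∃ σ' : BobStrategy B M.full m, σ'.Extends σ := by
  choose T hT using fun j => (σ.step j).exists_extension (X := Unit × B.X)
    (Prod.map (fun _ => ()) B.label) fun i j h e => h (Prod.ext rfl (Prod.ext_iff.mp e).2)
  exact ⟨⟨σ.init, T, σ.meas⟩, rfl, hT, rfl⟩

theorem AliceStrategy.exists_extends (σ : AliceStrategy A M m) :
    ∃ σ' : AliceStrategy A M.full m, σ'.Extends σ := by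
  choose T hT using fun j => (σ.step j).exists_extension (X := A.X × Unit)
    (Prod.map A.label fun _ => ()) fun i j h e => h (Prod.ext (Prod.ext_iff.mp e).1 rfl)
  exact ⟨⟨⟨σ.init.op, fun i j h => σ.init.mem i j fun e => h (Prod.ext (Prod.ext_iff.mp e).1 rfl),
    σ.init.posSemidef, σ.init.trace_eq_one⟩, T, σ.meas⟩, rfl, hT, rfl⟩

/-- The state `ρ'` of the game with Alice's register reduces to the state `ρ` of the game
without it. -/
def AliceReduces (S : Set (Fin d))
    (ρ' : (((ObsAlg.quantum (A.ι × Fin d)).tensor M.full).tensor B).alg)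
    (ρ : ((A.tensor M).tensor B).alg) : Prop :=
  ∀ b b', Reduces S
    (of fun p q : (A.ι × M.ι) × Fin d => ρ'.1 (((p.1.1, p.2), p.1.2), b) (((q.1.1, q.2), q.1.2), b'))
    (of fun p q : A.ι × M.ι => ρ.1 (p, b) (q, b'))

/-- The state `ρ'` of the game with Bob's register reduces to the state `ρ` of the game
without it. -/
def BobReduces (S : Set (Fin d))
    (ρ' : ((A.tensor M.full).tensor (ObsAlg.quantum (B.ι × Fin d))).alg)
    (ρ : ((A.tensor M).tensor B).alg) : Prop :=
  ∀ a a', Reduces S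
    (of fun p q : (M.ι × B.ι) × Fin d => ρ'.1 ((a, p.1.1), (p.1.2, p.2)) ((a', q.1.1), (q.1.2, q.2)))
    (of fun p q : M.ι × B.ι => ρ.1 ((a, p.1), p.2) ((a', q.1), q.2))

/-- Bob's map acts on blocks indexed by Alice's space and is linear, so it sends zero blocks to zero
and commutes with the sum over her register. -/
theorem AliceReduces.bob_step {S : Set (Fin d)}
    {ρ' : (((ObsAlg.quantum (A.ι × Fin d)).tensor M.full).tensor B).alg}
    {ρ : ((A.tensor M).tensor B).alg} (h : AliceReduces S ρ' ρ)
    {T' : (M.full.tensor B).alg →ₗ[ℂ] (M.full.tensor B).alg}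
    {T : (M.tensor B).alg →ₗ[ℂ] (M.tensor B).alg}
    (hT : ∀ (τ' : (M.full.tensor B).alg) (τ : (M.tensor B).alg), τ'.1 = τ.1 →
      (T' τ').1 = (T τ).1) :
    AliceReduces S
      (ObsAlg.assocInv _ _ _ (ObsAlg.ampLeft (ObsAlg.quantum (A.ι × Fin d)) T'
        (ObsAlg.assoc _ _ _ ρ')))
      (ObsAlg.assocInv _ _ _ (ObsAlg.ampLeft A T (ObsAlg.assoc _ _ _ ρ))) := by
  intro b b'
  have h0 : ∀ p q : A.ι × Fin d, (p.2 ∉ S ∨ q.2 ∉ S) →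
      ObsAlg.blockRight _ _ p q (ObsAlg.assoc _ _ _ ρ') = 0 := by
    rintro ⟨a, e⟩ ⟨a', e'⟩ hpq
    apply Subtype.ext
    ext ⟨μ, β⟩ ⟨μ', β'⟩
    rcases hpq with hp | hq
    · exact (h β β').left ((a, μ), e) ((a', μ'), e') hp
    · exact (h β β').right ((a, μ), e) ((a', μ'), e') hq
  refine ⟨fun p q hp => ?_, fun p q hq => ?_, fun i i' => ?_⟩
  · change (T' (ObsAlg.blockRight _ _ (p.1.1, p.2) (q.1.1, q.2) (ObsAlg.assoc _ _ _ ρ'))).1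
      (p.1.2, b) (q.1.2, b') = 0
    rw [h0 _ _ (Or.inl hp), map_zero]
    rfl
  · change (T' (ObsAlg.blockRight _ _ (p.1.1, p.2) (q.1.1, q.2) (ObsAlg.assoc _ _ _ ρ'))).1
      (p.1.2, b) (q.1.2, b') = 0
    rw [h0 _ _ (Or.inr hq), map_zero]
    rfl
  · change ∑ e, (T' (ObsAlg.blockRight _ _ (i.1, e) (i'.1, e) (ObsAlg.assoc _ _ _ ρ'))).1
      (i.2, b) (i'.2, b') =
        (T (ObsAlg.blockRight _ _ i.1 i'.1 (ObsAlg.assoc _ _ _ ρ))).1 (i.2, b) (i'.2, b')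
    -- A single register block need not lie in `M ⊗ B`, but the sum over the register is a block of
    -- `ρ` and does. Only there are `T'` and `T` known to agree.
    rw [← hT (∑ e, ObsAlg.blockRight _ _ (i.1, e) (i'.1, e) (ObsAlg.assoc _ _ _ ρ')), map_sum,
      Submodule.coe_sum, Matrix.sum_apply]
    rw [Submodule.coe_sum]
    ext ⟨μ, β⟩ ⟨μ', β'⟩
    rw [Matrix.sum_apply]
    exact (h β β').sum_eq (i.1, μ) (i'.1, μ')

/-- `Reduces.conj` on each block over Bob's space; `prodRightComm` moves the register past the
mailbox into last position. -/
theorem AliceReduces.alice_step {κ : Type} [Fintype κ] {S S' : Set (Fin d)}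
    {ρ' : (((ObsAlg.quantum (A.ι × Fin d)).tensor M.full).tensor B).alg}
    {ρ : ((A.tensor M).tensor B).alg} (h : AliceReduces S ρ' ρ)
    {K : κ → Matrix (A.ι × M.ι) (A.ι × M.ι) ℂ} {f : κ × Fin d → Fin d}
    (hf : Set.InjOn f (Set.univ ×ˢ S)) (hS : Set.MapsTo f (Set.univ ×ˢ S) S')
    {U : Matrix ((A.ι × M.ι) × Fin d) ((A.ι × M.ι) × Fin d) ℂ}
    (hU : ∀ q : (A.ι × M.ι) × Fin d, q.2 ∈ S → ∀ p, U p q = dilation K f p q)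
    {T' : Channel ((ObsAlg.quantum (A.ι × Fin d)).tensor M.full)
      ((ObsAlg.quantum (A.ι × Fin d)).tensor M.full)} {T : Channel (A.tensor M) (A.tensor M)}
    (hT' : ∀ τ, (T'.map τ).1 = U.submatrix (prodRightComm _ _ _) (prodRightComm _ _ _) *
      τ.1 * (U.submatrix (prodRightComm _ _ _) (prodRightComm _ _ _))ᴴ)
    (hT : ∀ τ, (T.map τ).1 = ∑ k, K k * τ.1 * (K k)ᴴ) :
    AliceReduces S' (ObsAlg.ampRight T'.map B ρ') (ObsAlg.ampRight T.map B ρ) := by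
  intro b b'
  have h1 := (h b b').conj hf hS hU
  convert h1 using 1
  · change (T'.map (ObsAlg.blockLeft _ _ b b' ρ')).1.submatrix (prodRightComm _ _ _)
      (prodRightComm _ _ _) = _
    rw [hT', conjTranspose_submatrix, ← submatrix_mul_equiv _ _ _ (prodRightComm _ _ _),
      ← submatrix_mul_equiv _ _ _ (prodRightComm _ _ _)]
    rfl
  · exact hT (ObsAlg.blockLeft _ _ b b' ρ)

theorem AliceReduces.trace_eq {S : Set (Fin d)}
    {ρ' : (((ObsAlg.quantum (A.ι × Fin d)).tensor M.full).tensor B).alg}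
    {ρ : ((A.tensor M).tensor B).alg} (h : AliceReduces S ρ' ρ)
    {F : Matrix (A.ι × Fin d) (A.ι × Fin d) ℂ} {E : Matrix A.ι A.ι ℂ}
    (hF : ∀ p q : A.ι × Fin d, p.2 ∈ S → q.2 ∈ S → F p q = if p.2 = q.2 then E p.1 q.1 else 0)
    (E' : Matrix B.ι B.ι ℂ) :
    (((E ⊗ₖ (1 : Matrix M.ι M.ι ℂ)) ⊗ₖ E') * ρ.1).trace =
      (((F ⊗ₖ (1 : Matrix M.ι M.ι ℂ)) ⊗ₖ E') * ρ'.1).trace := by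
  simp_rw [trace_kronecker_mul]
  refine Finset.sum_congr rfl fun b _ => Finset.sum_congr rfl fun b' _ => congrArg _ <|
    Finset.sum_congr rfl fun μ _ => Finset.sum_congr rfl fun μ' _ => congrArg _ ?_
  have h1 : Reduces S (of fun p q : A.ι × Fin d => ρ'.1 ((p, μ'), b') ((q, μ), b))
      (of fun i j => ρ.1 ((i, μ'), b') ((j, μ), b)) :=
    ⟨fun p q hp => (h b' b).left ((p.1, μ'), p.2) ((q.1, μ), q.2) hp,
      fun p q hq => (h b' b).right ((p.1, μ'), p.2) ((q.1, μ), q.2) hq,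
      fun i i' => (h b' b).sum_eq (i, μ') (i', μ)⟩
  exact (h1.trace_mul hF).symm

/-- The mirror image of `AliceReduces.bob_step`: agreement of `T'` with `T` is used only after
summing over Bob's register. -/
theorem BobReduces.alice_step {S : Set (Fin d)}
    {ρ' : ((A.tensor M.full).tensor (ObsAlg.quantum (B.ι × Fin d))).alg}
    {ρ : ((A.tensor M).tensor B).alg} (h : BobReduces S ρ' ρ)
    {T' : (A.tensor M.full).alg →ₗ[ℂ] (A.tensor M.full).alg}
    {T : (A.tensor M).alg →ₗ[ℂ] (A.tensor M).alg}
    (hT : ∀ (τ' : (A.tensor M.full).alg) (τ : (A.tensor M).alg), τ'.1 = τ.1 →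
      (T' τ').1 = (T τ).1) :
    BobReduces S (ObsAlg.ampRight T' (ObsAlg.quantum (B.ι × Fin d)) ρ')
      (ObsAlg.ampRight T B ρ) := by
  intro a a'
  have h0 : ∀ p q : B.ι × Fin d, (p.2 ∉ S ∨ q.2 ∉ S) →
      ObsAlg.blockLeft _ (ObsAlg.quantum (B.ι × Fin d)) p q ρ' = 0 := by
    rintro ⟨β, e⟩ ⟨β', e'⟩ hpq
    apply Subtype.ext
    ext ⟨α, μ⟩ ⟨α', μ'⟩
    rcases hpq with hp | hq
    · exact (h α α').left ((μ, β), e) ((μ', β'), e') hp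
    · exact (h α α').right ((μ, β), e) ((μ', β'), e') hq
  refine ⟨fun p q hp => ?_, fun p q hq => ?_, fun i i' => ?_⟩
  · change (T' (ObsAlg.blockLeft _ (ObsAlg.quantum (B.ι × Fin d)) (p.1.2, p.2) (q.1.2, q.2) ρ')).1
      (a, p.1.1) (a', q.1.1) = 0
    rw [h0 _ _ (Or.inl hp), map_zero]
    rfl
  · change (T' (ObsAlg.blockLeft _ (ObsAlg.quantum (B.ι × Fin d)) (p.1.2, p.2) (q.1.2, q.2) ρ')).1
      (a, p.1.1) (a', q.1.1) = 0
    rw [h0 _ _ (Or.inr hq), map_zero]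
    rfl
  · change ∑ e, (T' (ObsAlg.blockLeft _ (ObsAlg.quantum (B.ι × Fin d)) (i.2, e) (i'.2, e) ρ')).1
      (a, i.1) (a', i'.1) = (T (ObsAlg.blockLeft _ _ i.2 i'.2 ρ)).1 (a, i.1) (a', i'.1)
    rw [← hT (∑ e, ObsAlg.blockLeft _ (ObsAlg.quantum (B.ι × Fin d)) (i.2, e) (i'.2, e) ρ'),
      map_sum, Submodule.coe_sum, Matrix.sum_apply]
    rw [Submodule.coe_sum]
    ext ⟨α, μ⟩ ⟨α', μ'⟩
    rw [Matrix.sum_apply]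
    exact (h α α').sum_eq (μ, i.2) (μ', i'.2)

theorem BobReduces.bob_step {κ : Type} [Fintype κ] {S S' : Set (Fin d)}
    {ρ' : ((A.tensor M.full).tensor (ObsAlg.quantum (B.ι × Fin d))).alg}
    {ρ : ((A.tensor M).tensor B).alg} (h : BobReduces S ρ' ρ)
    {K : κ → Matrix (M.ι × B.ι) (M.ι × B.ι) ℂ} {f : κ × Fin d → Fin d}
    (hf : Set.InjOn f (Set.univ ×ˢ S)) (hS : Set.MapsTo f (Set.univ ×ˢ S) S')
    {U : Matrix ((M.ι × B.ι) × Fin d) ((M.ι × B.ι) × Fin d) ℂ}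
    (hU : ∀ q : (M.ι × B.ι) × Fin d, q.2 ∈ S → ∀ p, U p q = dilation K f p q)
    {T' : Channel (M.full.tensor (ObsAlg.quantum (B.ι × Fin d)))
      (M.full.tensor (ObsAlg.quantum (B.ι × Fin d)))} {T : Channel (M.tensor B) (M.tensor B)}
    (hT' : ∀ τ, (T'.map τ).1 =
      U.submatrix (Equiv.prodAssoc _ _ _).symm (Equiv.prodAssoc _ _ _).symm *
      τ.1 * (U.submatrix (Equiv.prodAssoc _ _ _).symm (Equiv.prodAssoc _ _ _).symm)ᴴ)
    (hT : ∀ τ, (T.map τ).1 = ∑ k, K k * τ.1 * (K k)ᴴ) :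
    BobReduces S' (ObsAlg.assocInv _ _ _ (ObsAlg.ampLeft A T'.map (ObsAlg.assoc _ _ _ ρ')))
      (ObsAlg.assocInv _ _ _ (ObsAlg.ampLeft A T.map (ObsAlg.assoc _ _ _ ρ))) := by
  intro a a'
  have h1 := (h a a').conj hf hS hU
  convert h1 using 1
  · change (T'.map (ObsAlg.blockRight _ _ a a' (ObsAlg.assoc _ _ _ ρ'))).1.submatrix
      (Equiv.prodAssoc _ _ _) (Equiv.prodAssoc _ _ _) = _
    rw [hT', conjTranspose_submatrix, ← submatrix_mul_equiv _ _ _ (Equiv.prodAssoc _ _ _),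
      ← submatrix_mul_equiv _ _ _ (Equiv.prodAssoc _ _ _)]
    simp only [submatrix_submatrix, Equiv.symm_comp_self, submatrix_id_id]
    rfl
  · exact hT (ObsAlg.blockRight _ _ a a' (ObsAlg.assoc _ _ _ ρ))

theorem BobReduces.trace_eq {S : Set (Fin d)}
    {ρ' : ((A.tensor M.full).tensor (ObsAlg.quantum (B.ι × Fin d))).alg}
    {ρ : ((A.tensor M).tensor B).alg} (h : BobReduces S ρ' ρ)
    {F : Matrix (B.ι × Fin d) (B.ι × Fin d) ℂ} {E : Matrix B.ι B.ι ℂ}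
    (hF : ∀ p q : B.ι × Fin d, p.2 ∈ S → q.2 ∈ S → F p q = if p.2 = q.2 then E p.1 q.1 else 0)
    (E' : Matrix (A.ι × M.ι) (A.ι × M.ι) ℂ) :
    ((E' ⊗ₖ E) * ρ.1).trace = ((E' ⊗ₖ F) * ρ'.1).trace := by
  simp_rw [trace_kronecker_mul']
  refine Finset.sum_congr rfl fun c _ => Finset.sum_congr rfl fun c' _ => congrArg _ ?_
  have h1 : Reduces S (of fun p q : B.ι × Fin d => ρ'.1 (c', p) (c, q))
      (of fun i j => ρ.1 (c', i) (c, j)) :=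
    ⟨fun p q hp => (h c'.1 c.1).left ((c'.2, p.1), p.2) ((c.2, q.1), q.2) hp,
      fun p q hq => (h c'.1 c.1).right ((c'.2, p.1), p.2) ((c.2, q.1), q.2) hq,
      fun i i' => (h c'.1 c.1).sum_eq (c'.2, i) (c.2, i')⟩
  exact (h1.trace_mul hF).symm

end Game

/-! ### Assembly of the unitary strategies -/

section NormalForm

variable {M : ObsAlg} {m : ℕ}

instance : Nonempty Outcome :=
  ⟨Outcome.fail⟩

theorem AliceStrategy.exists_unitary {A : ObsAlg} (σA : AliceStrategy A M m) :
    ∃ (d : ℕ) (σA' : AliceStrategy (ObsAlg.quantum (A.ι × Fin d)) M.full m),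
      σA'.IsUnitary ∧ ∀ (B : ObsAlg) (σB : BobStrategy B M m) (σB' : BobStrategy B M.full m),
        σB'.Extends σB → ∀ x y, prob σA σB x y = prob σA' σB' x y := by
  obtain ⟨d, S, init, step, final, color, hinit, hinitS, hstep, hfinal, hcolor⟩ :=
    exists_register (A.ι × M.ι) (Option ((A.ι × M.ι) × (A.ι × M.ι))) Outcome
      m
  have hN : (ObsAlg.quantum (A.ι × Fin d)).IsQuantum := isQuantum_quantum _
  have hM : M.full.IsQuantum := isQuantum_quantum _
  choose K hK hKT using fun j => (σA.step j).exists_kraus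
  choose U hU hUK using fun j => exists_unitary_dilation (K j) (hK j) (hstep j).1
  obtain ⟨ψ, hψ⟩ := exists_purification σA.init.posSemidef hinit hinitS
  obtain ⟨F, hF, hFsum, hFE⟩ := exists_projective_dilation σA.meas.op σA.meas.posSemidef
    σA.meas.sum_eq_one hfinal color hcolor
  obtain ⟨ρ₀, hpure, hρ₀⟩ := State.exists_pure (hN.tensor hM)
    -- The purification has norm one because the partial trace preserves the trace.
    (fun p => ψ (prodRightComm _ _ _ p)) <| by
      rw [(prodRightComm A.ι (Fin d) M.ι).sum_comp fun p => ψ p * star (ψ p)]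
      exact hψ.trace_eq.trans σA.init.trace_eq_one
  choose T hTU hT using fun j => Channel.exists_isUnitary (hN.tensor hM)
    (submatrix_mem_unitaryGroup (hU j) (prodRightComm A.ι (Fin d) M.ι))
  obtain ⟨E, hE, hEF⟩ := POVM.exists_isProjectionValued hN hF hFsum
  refine ⟨d, ⟨ρ₀, T, E⟩, ⟨hN, hM, hpure, hTU, hE⟩, fun B σB σB' hσ x y => ?_⟩
  have key : AliceReduces (S m) (finalState ⟨ρ₀, T, E⟩ σB') (finalState σA σB) := by
    refine foldl_induction₂ m (fun j ρ' ρ => AliceReduces (S j) ρ' ρ) _ _ _ _ ?_ ?_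
    · intro b b'
      convert hψ.smul (σB.init.op b b') using 1
      · ext p q
        simp only [initialState, hρ₀, hσ.init_eq, of_apply, kroneckerMap_apply,
          Matrix.smul_apply, smul_eq_mul]
        exact mul_comm _ _
      · ext p q
        exact mul_comm _ _
    · intro j ρ' ρ h
      refine (h.bob_step (hσ.step_eq j)).alice_step (hstep j).1 (hstep j).2 (hUK j) (hT j) ?_
      intro τ
      -- The Kraus operators describe `T` after pinching; states of the original game are already
      -- pinched.
      rw [← hKT, ObsAlg.pinch_coe]
  simp only [prob, hEF, hσ.meas_eq]
  exact key.trace_eq (hFE x) _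

theorem BobStrategy.exists_unitary {B : ObsAlg} (σB : BobStrategy B M m) :
    ∃ (d : ℕ) (σB' : BobStrategy (ObsAlg.quantum (B.ι × Fin d)) M.full m),
      σB'.IsUnitary ∧ ∀ (A : ObsAlg) (σA : AliceStrategy A M m) (σA' : AliceStrategy A M.full m),
        σA'.Extends σA → ∀ x y, prob σA σB x y = prob σA' σB' x y := by
  obtain ⟨d, S, init, step, final, color, hinit, hinitS, hstep, hfinal, hcolor⟩ :=
    exists_register B.ι (Option ((M.ι × B.ι) × (M.ι × B.ι))) Outcome
      m
  have hN : (ObsAlg.quantum (B.ι × Fin d)).IsQuantum := isQuantum_quantum _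
  have hM : M.full.IsQuantum := isQuantum_quantum _
  choose K hK hKT using fun j => (σB.step j).exists_kraus
  choose U hU hUK using fun j => exists_unitary_dilation (K j) (hK j) (hstep j).1
  obtain ⟨ψ, hψ⟩ := exists_purification σB.init.posSemidef hinit hinitS
  obtain ⟨F, hF, hFsum, hFE⟩ := exists_projective_dilation σB.meas.op σB.meas.posSemidef
    σB.meas.sum_eq_one hfinal color hcolor
  obtain ⟨ρ₀, hpure, hρ₀⟩ := State.exists_pure hN ψ (hψ.trace_eq.trans σB.init.trace_eq_one)
  choose T hTU hT using fun j => Channel.exists_isUnitary (hM.tensor hN)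
    (submatrix_mem_unitaryGroup (hU j) (Equiv.prodAssoc M.ι B.ι (Fin d)).symm)
  obtain ⟨E, hE, hEF⟩ := POVM.exists_isProjectionValued hN hF hFsum
  refine ⟨d, ⟨ρ₀, T, E⟩, ⟨hN, hM, hpure, hTU, hE⟩, fun A σA σA' hσ x y => ?_⟩
  have key : BobReduces (S m) (finalState σA' ⟨ρ₀, T, E⟩) (finalState σA σB) := by
    refine foldl_induction₂ m (fun j ρ' ρ => BobReduces (S j) ρ' ρ) _ _ _ _ ?_ ?_
    -- Only Bob's factor of the product state is purified, so Alice's matrix entry is a common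
    -- scalar in each block.
    · intro a a'
      refine ⟨fun p q hp => ?_, fun p q hq => ?_, fun i i' => ?_⟩
      · have h0 : ρ₀.op (p.1.2, p.2) (q.1.2, q.2) = 0 := by
          rw [hρ₀]
          exact hψ.left (p.1.2, p.2) (q.1.2, q.2) hp
        exact mul_eq_zero_of_right _ h0
      · have h0 : ρ₀.op (p.1.2, p.2) (q.1.2, q.2) = 0 := by
          rw [hρ₀]
          exact hψ.right (p.1.2, p.2) (q.1.2, q.2) hq
        exact mul_eq_zero_of_right _ h0
      · change ∑ e, σA'.init.op (a, i.1) (a', i'.1) * ρ₀.op (i.2, e) (i'.2, e) =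
          σA.init.op (a, i.1) (a', i'.1) * σB.init.op i.2 i'.2
        rw [← Finset.mul_sum, hσ.init_eq, hρ₀, ← hψ.sum_eq i.2 i'.2]
    · intro j ρ' ρ h
      refine (h.bob_step (hstep j).1 (hstep j).2 (hUK j) (hT j) ?_).alice_step (hσ.step_eq j)
      intro τ
      rw [← hKT, ObsAlg.pinch_coe]
  simp only [prob, hEF, hσ.meas_eq]
  exact key.trace_eq (hFE y) _

end NormalForm

end CoinToss

theorem proposition2 (M : CoinToss.ObsAlg) (m : ℕ) :
    (∀ (A : CoinToss.ObsAlg) (σA : CoinToss.AliceStrategy A M m),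
      ∃ (d : ℕ) (σA' : CoinToss.AliceStrategy (CoinToss.ObsAlg.quantum (A.ι × Fin d)) M.full m),
        σA'.IsUnitary ∧
        ∀ (B : CoinToss.ObsAlg) (σB : CoinToss.BobStrategy B M m),
          (∃ σB' : CoinToss.BobStrategy B M.full m, σB'.Extends σB) ∧
          ∀ σB' : CoinToss.BobStrategy B M.full m, σB'.Extends σB →
            ∀ x y : CoinToss.Outcome,
              CoinToss.prob σA σB x y = CoinToss.prob σA' σB' x y) ∧
    (∀ (B : CoinToss.ObsAlg) (σB : CoinToss.BobStrategy B M m),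
      ∃ (d : ℕ) (σB' : CoinToss.BobStrategy (CoinToss.ObsAlg.quantum (B.ι × Fin d)) M.full m),
        σB'.IsUnitary ∧
        ∀ (A : CoinToss.ObsAlg) (σA : CoinToss.AliceStrategy A M m),
          (∃ σA' : CoinToss.AliceStrategy A M.full m, σA'.Extends σA) ∧
          ∀ σA' : CoinToss.AliceStrategy A M.full m, σA'.Extends σA →
            ∀ x y : CoinToss.Outcome,
              CoinToss.prob σA σB x y = CoinToss.prob σA' σB' x y) := by

  refine ⟨fun A σA => ?_, fun B σB => ?_⟩
  · obtain ⟨d, σA', hU, h⟩ := σA.exists_unitary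
    exact ⟨d, σA', hU, fun B σB => ⟨σB.exists_extends, h B σB⟩⟩
  · obtain ⟨d, σB', hU, h⟩ := σB.exists_unitary
    exact ⟨d, σB', hU, fun A σA => ⟨σA.exists_extends, h A σA⟩⟩
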